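/- Let $0<p<\infty$ and let $u,v,w$ be weights, i.e. non-negative locally integrable functions on $(0,\infty)$. Put $U(t)=\int_0^t u(s)\,ds$ and assume that $U^{1/p}$ is admissible: finite, continuous and strictly increasing on $[0,\infty)$, with $U(0)=0$ and $\lim_{t\to\infty}U(t)=\infty$. Let $$\varphi(t)=\operatorname*{ess\,sup}_{s\in(0,t)}U(s)^{1/p}\operatorname*{ess\,sup}_{\tau\in(s,\infty)}\frac{w(\tau)}{U(\tau)^{1/p}},\qquad t\in(0,\infty),$$ and assume that $\varphi$ is non-degenerate with respect to $U^{1/p}$: $$\lim_{t\to0+}\varphi(t)=\lim_{t\to\infty}\frac1{\varphi(t)}=\lim_{t\to\infty}\frac{\varphi(t)}{U(t)^{1/p}}=\lim_{t\to0+}\frac{U(t)^{1/p}}{\varphi(t)}=0.$$ Let $\{x_k\}_{k\in\mathbb Z}\subset(0,\infty)$ be any discretizing sequence for $\varphi$ with respect to $U^{1/p}$. This means that $x_0=1$ and that there are constants $r>1$ and $K$ such that, for all $k\in\mathbb Z$, $$U(x_{k+1})^{1/p}\ge r\,U(x_k)^{1/p},\qquad \varphi(x_{k+1})\ge r\,\varphi(x_k),\qquad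 \frac{\varphi(x_{k+1})}{U(x_{k+1})^{1/p}}\le \frac1r\,\frac{\varphi(x_k)}{U(x_k)^{1/p}},$$ all these numbers being positive and finite, and there is a decomposition $\mathbb Z=\mathbb Z_1\cup\mathbb Z_2$, $\mathbb Z_1\cap\mathbb Z_2=\emptyset$, such that for every $t\in[x_k,x_{k+1}]$ $$K^{-1}\varphi(t)\le\varphi(x_k)\le K\varphi(t)\ \text{ if }k\in\mathbb Z_1,\qquad K^{-1}\frac{\varphi(t)}{U(t)^{1/p}}\le\frac{\varphi(x_k)}{U(x_k)^{1/p}}\le K\frac{\varphi(t)}{U(t)^{1/p}}\ \text{ if }k\in\mathbb Z_2 .$$ For $0<a<b<\infty$ let $$B(a,b)=\sup_{h}\frac{\left(\int_a^b\left(\int_s^b h(z)\,dz\right)^p u(s)\,ds\right)^{1/p}}{\int_a^b h(z)v(z)\,dz},\qquad C(a,b)=\sup_{h}\frac{\int_a^b h(z)\,dz}{\int_a^b h(z)v(z)\,dz},$$ the suprema being taken over all non-negative measurable $h$ on $(a,b)$, with the conventions $0/0=\infty/\infty=0$ and $c/0=\infty$ for $c\in(0,\infty]$. Set $$D:=\sup_{k\in\mathbb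 Z}\frac{\varphi(x_k)}{U(x_k)^{1/p}}B(x_{k-1},x_k)+\sup_{k\in\mathbb Z}\varphi(x_k)\,C(x_k,x_{k+1}).$$ Then there is a finite constant $c$ such that the inequality $$\operatorname*{ess\,sup}_{t\in(0,\infty)}w(t)\left(\frac1{U(t)}\int_0^t\left(\int_s^\infty h(z)\,dz\right)^p u(s)\,ds\right)^{1/p}\le c\int_0^\infty h(z)v(z)\,dz$$ holds for every non-negative measurable $h$ on $(0,\infty)$ if and only if $D<\infty$. Moreover, the best (least) constant $c$ in this inequality (with $c=\infty$ if there is no finite one) satisfies $c\approx D$, i.e. $c\le M D$ and $D\le M c$ for a finite constant $M$ depending only on $p$, $r$ and $K$. -/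

import Mathlib

open MeasureTheory Set Filter Topology
open scoped ENNReal NNReal

noncomputable section

namespace IteratedHardy

/-- A weight on `(0, ∞)`: a non-negative, locally integrable function. -/
structure IsWeight (u : ℝ → ℝ) : Prop where
  nonneg : ∀ t, 0 < t → 0 ≤ u t
  locallyIntegrable : LocallyIntegrableOn u (Ioi 0)

/-- Membership in `𝓜⁺(I)`: `f` is non-negative and (Lebesgue) measurable on `I`.
The values of `f` outside `I` are irrelevant. -/
def MPlus (I : Set ℝ) (f : ℝ → ℝ≥0∞) : Prop :=
  AEMeasurable f (volume.restrict I)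

/-- The weighted functional `‖f‖_{p,u,I} = (∫_I f ^ p u) ^ (1/p)`, for `0 < p < ∞`. -/
def wnorm (p : ℝ) (u : ℝ → ℝ) (I : Set ℝ) (f : ℝ → ℝ≥0∞) : ℝ≥0∞ :=
  (∫⁻ s in I, f s ^ p * ENNReal.ofReal (u s)) ^ (1 / p)

/-- `U(t) = ∫_0^t u(s) ds`. -/
def primitive (u : ℝ → ℝ) (t : ℝ) : ℝ≥0∞ :=
  ∫⁻ s in Ioo 0 t, ENNReal.ofReal (u s)

/-- The function `U ^ (1/p)`. -/
def primitivePow (p : ℝ) (u : ℝ → ℝ) (t : ℝ) : ℝ≥0∞ :=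
  primitive u t ^ (1 / p)

/-- Admissible functions: finite, continuous and strictly increasing on `[0, ∞)`,
vanishing at `0` and tending to `∞` at `∞`. -/
structure Admissible (G : ℝ → ℝ≥0∞) : Prop where
  finite : ∀ t, 0 ≤ t → G t < ⊤
  continuousOn : ContinuousOn G (Ici 0)
  strictMonoOn : StrictMonoOn G (Ici 0)
  zero : G 0 = 0
  tendsto_atTop : Tendsto G atTop (𝓝 ⊤)

/-- `φ(t) = ess sup_{0 < s < t} U(s)^(1/p) ess sup_{τ > s} w(τ) / U(τ)^(1/p)`. -/
def phi (p : ℝ) (u w : ℝ → ℝ) (t : ℝ) : ℝ≥0∞ :=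
  essSup (fun s => primitivePow p u s *
      essSup (fun τ => ENNReal.ofReal (w τ) / primitivePow p u τ) (volume.restrict (Ioi s)))
    (volume.restrict (Ioo 0 t))

/-- Non-degeneracy of `φ` with respect to the admissible function `G`. -/
structure NonDegenerate (G φ : ℝ → ℝ≥0∞) : Prop where
  phi_zero : Tendsto φ (𝓝[>] 0) (𝓝 0)
  inv_phi_top : Tendsto (fun t => 1 / φ t) atTop (𝓝 0)
  phi_div_top : Tendsto (fun t => φ t / G t) atTop (𝓝 0)
  div_phi_zero : Tendsto (fun t => G t / φ t) (𝓝[>] 0) (𝓝 0)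

/-- A sequence of positive real numbers. -/
def PosReal (a : ℤ → ℝ≥0∞) : Prop := ∀ k, 0 < a k ∧ a k < ⊤

/-- `a_k ↑↑`. -/
def GeomIncreasing (a : ℤ → ℝ≥0∞) : Prop :=
  PosReal a ∧ 1 < ⨅ k, a (k + 1) / a k

/-- `a_k ↓↓`. -/
def GeomDecreasing (a : ℤ → ℝ≥0∞) : Prop :=
  PosReal a ∧ ⨆ k, a (k + 1) / a k < 1

/-- `a ≈ b` with constant `K`. -/
def EquivWith (K : ℝ≥0) (a b : ℝ≥0∞) : Prop := a ≤ K * b ∧ b ≤ K * a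

/-- Third condition on a discretizing sequence, with an explicit constant `K`: on each
`[x_k, x_{k+1}]` either `φ` or `φ / G` is equivalent to its value at `x_k`. -/
def Decomposes (K : ℝ≥0) (G φ : ℝ → ℝ≥0∞) (x : ℤ → ℝ) : Prop :=
  ∃ Z₁ Z₂ : Set ℤ, Z₁ ∪ Z₂ = univ ∧ Z₁ ∩ Z₂ = ∅ ∧
    (∀ k ∈ Z₁, ∀ t ∈ Icc (x k) (x (k + 1)), EquivWith K (φ (x k)) (φ t)) ∧
    (∀ k ∈ Z₂, ∀ t ∈ Icc (x k) (x (k + 1)), EquivWith K (φ (x k) / G (x k)) (φ t / G t))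

/-- `x` is a discretizing sequence in `(0, ∞)` for `φ` with respect to `G`. -/
structure IsDiscretizing (G φ : ℝ → ℝ≥0∞) (x : ℤ → ℝ) : Prop where
  pos : ∀ k, 0 < x k
  zero : x 0 = 1
  geom_G : GeomIncreasing (fun k => G (x k))
  geom_phi : GeomIncreasing (fun k => φ (x k))
  geom_div : GeomDecreasing (fun k => φ (x k) / G (x k))
  decomp : ∃ K : ℝ≥0, Decomposes K G φ x

/-- A discretizing sequence whose geometric growth/decay is at least of ratio `r` and whose
equivalences hold with constant `K`. Every discretizing sequence is of this kind for some
`r > 1` and `K`, see `isDiscretizing_iff`. -/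
structure IsDiscretizingWith (r K : ℝ≥0) (G φ : ℝ → ℝ≥0∞) (x : ℤ → ℝ) : Prop where
  isDiscretizing : IsDiscretizing G φ x
  ratio_G : (r : ℝ≥0∞) ≤ ⨅ k, G (x (k + 1)) / G (x k)
  ratio_phi : (r : ℝ≥0∞) ≤ ⨅ k, φ (x (k + 1)) / φ (x k)
  ratio_div : ⨆ k, (φ (x (k + 1)) / G (x (k + 1))) / (φ (x k) / G (x k)) ≤ (r : ℝ≥0∞)⁻¹
  decomp : Decomposes K G φ x

theorem isDiscretizing_iff (G φ : ℝ → ℝ≥0∞) (x : ℤ → ℝ) :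
    IsDiscretizing G φ x ↔ ∃ r K : ℝ≥0, 1 < r ∧ IsDiscretizingWith r K G φ x := by
  constructor
  · intro h
    obtain ⟨K, hK⟩ := h.decomp
    have h1 := h.geom_G.2
    have h2 := h.geom_phi.2
    have h3 := ENNReal.one_lt_inv.2 h.geom_div.2
    obtain ⟨r, hr1, hr2⟩ := ENNReal.lt_iff_exists_nnreal_btwn.1 (lt_min h1 (lt_min h2 h3))
    have hr3 := lt_min_iff.1 hr2
    have hr4 := lt_min_iff.1 hr3.2
    refine ⟨r, K, by exact_mod_cast hr1, h, hr3.1.le, hr4.1.le, ?_, hK⟩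
    exact ENNReal.le_inv_iff_le_inv.1 hr4.2.le
  · rintro ⟨r, K, -, h⟩
    exact h.isDiscretizing

/-- `B(a, b) = sup_h ‖∫_s^b h‖_{p,u,(a,b)} / ‖h‖_{1,v,(a,b)}`. Division in `ℝ≥0∞` obeys the
conventions `0 / 0 = 0`, `∞ / ∞ = 0` and `c / 0 = ∞` for `c > 0`. -/
def constB (p : ℝ) (u v : ℝ → ℝ) (a b : ℝ) : ℝ≥0∞ :=
  ⨆ (h : ℝ → ℝ≥0∞) (_ : MPlus (Ioo a b) h),
    wnorm p u (Ioo a b) (fun s => ∫⁻ z in Ioo s b, h z) / wnorm 1 v (Ioo a b) h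

/-- `C(a, b) = sup_h ‖h‖_{1,(a,b)} / ‖h‖_{1,v,(a,b)}`. -/
def constC (v : ℝ → ℝ) (a b : ℝ) : ℝ≥0∞ :=
  ⨆ (h : ℝ → ℝ≥0∞) (_ : MPlus (Ioo a b) h),
    wnorm 1 (fun _ => 1) (Ioo a b) h / wnorm 1 v (Ioo a b) h

/-- The inequality
`ess sup_{t > 0} w(t) ((1/U(t)) ∫_0^t (∫_s^∞ h)^p u(s) ds)^(1/p) ≤ c ∫_0^∞ h v`
for every `h ∈ 𝓜⁺(0, ∞)`. -/
def HardyIneq (p : ℝ) (u v w : ℝ → ℝ) (c : ℝ≥0) : Prop :=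
  ∀ h : ℝ → ℝ≥0∞, MPlus (Ioi 0) h →
    essSup (fun t => ENNReal.ofReal (w t) *
        (1 / primitive u t *
          ∫⁻ s in Ioo 0 t, (∫⁻ z in Ioi s, h z) ^ p * ENNReal.ofReal (u s)) ^ (1 / p))
      (volume.restrict (Ioi 0))
    ≤ c * ∫⁻ z in Ioi 0, h z * ENNReal.ofReal (v z)

/-- The best constant in the inequality; `∞` if it holds with no finite constant. -/
def bestConst (p : ℝ) (u v w : ℝ → ℝ) : ℝ≥0∞ :=
  ⨅ (c : ℝ≥0) (_ : HardyIneq p u v w c), (c : ℝ≥0∞)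

/-- `D = sup_k φ(x_k) U(x_k)^(-1/p) B(x_{k-1}, x_k) + sup_k φ(x_k) C(x_k, x_{k+1})`. -/
def constD (p : ℝ) (u v w : ℝ → ℝ) (x : ℤ → ℝ) : ℝ≥0∞ :=
  (⨆ k : ℤ, phi p u w (x k) / primitivePow p u (x k) * constB p u v (x (k - 1)) (x k)) +
    ⨆ k : ℤ, phi p u w (x k) * constC v (x k) (x (k + 1))

end IteratedHardy

end

namespace IteratedHardy

/-! Write `G = U^(1/p)` and `N(t) = (∫_0^t (∫_s^∞ h)^p u(s) ds)^(1/p)`. The tail of `h` is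
nonincreasing, so `N` is nondecreasing and `N / G` is nonincreasing. This permits replacing `w` by
`φ`: the left-hand side of the inequality equals `sup_t φ(t) N(t) / G(t)` (`le_hardyLHS`,
`hardyLHS_le`). Lower bound for the best constant: test with `h` supported in one interval and keep
a single `t`, the right endpoint for `B` and the left one for `C`. Upper bound: the decomposition of
`ℤ` and the monotonicity of `N` and `N / G` reduce all `t` to the points `x_k`
(`hardyLHS_le_of_discrete`). At `x_k`, cut `(0, x_k)` into blocks and, on each block, cut the tail
of `h` at the block's right endpoint. The local parts are controlled by `B`, the remaining tails by
`C`, and the geometric behaviour of `φ` and `φ / G` makes both sums geometric series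
(`phi_mul_tail_le`, `phi_div_mul_iteratedNorm_le`). -/

/-- `∫_0^t (∫_s^∞ h)^p u(s) ds`. -/
noncomputable def iteratedIntegral (p : ℝ) (u : ℝ → ℝ) (h : ℝ → ℝ≥0∞) (t : ℝ) : ℝ≥0∞ :=
  ∫⁻ s in Ioo 0 t, (∫⁻ z in Ioi s, h z) ^ p * ENNReal.ofReal (u s)

/-! ### Monotonicity of the iterated norm and of its quotient by `U^(1/p)` -/

theorem iteratedIntegral_mono (p : ℝ) (u : ℝ → ℝ) (h : ℝ → ℝ≥0∞) :
    Monotone (iteratedIntegral p u h) :=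
  fun _ _ hst => lintegral_mono_set (Ioo_subset_Ioo_right hst)

theorem lintegral_Ioo_split (f : ℝ → ℝ≥0∞) {a s t : ℝ} (has : a < s) (hst : s ≤ t) :
    ∫⁻ z in Ioo a t, f z = (∫⁻ z in Ioo a s, f z) + ∫⁻ z in Ico s t, f z := by
  rw [← Ioo_union_Ico_eq_Ioo has hst, lintegral_union measurableSet_Ico]
  rw [Set.disjoint_left]
  intro z hz hz'
  exact absurd hz.2 (not_lt.2 hz'.1)

theorem lintegral_tail_anti (h : ℝ → ℝ≥0∞) : Antitone fun s : ℝ => ∫⁻ z in Ioi s, h z :=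
  fun _ _ hst => lintegral_mono_set (Ioi_subset_Ioi hst)

theorem IsWeight.aemeasurable_ofReal {u : ℝ → ℝ} (hu : IsWeight u) :
    AEMeasurable (fun s => ENNReal.ofReal (u s)) (volume.restrict (Ioi 0)) :=
  (hu.locallyIntegrable.aestronglyMeasurable).aemeasurable.ennreal_ofReal

theorem IsWeight.lintegral_const_mul {u : ℝ → ℝ} (hu : IsWeight u) (c : ℝ≥0∞) {A : Set ℝ}
    (hA : A ⊆ Ioi 0) :
    ∫⁻ s in A, c * ENNReal.ofReal (u s) = c * ∫⁻ s in A, ENNReal.ofReal (u s) :=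
  lintegral_const_mul'' _ (hu.aemeasurable_ofReal.mono_measure (Measure.restrict_mono hA le_rfl))

/-- The mean `iteratedIntegral / primitive` is nonincreasing. -/
theorem iteratedIntegral_mul_primitive_le {p : ℝ} (hp : 0 < p) {u : ℝ → ℝ} (hu : IsWeight u)
    (h : ℝ → ℝ≥0∞) {s t : ℝ} (hs : 0 < s) (hst : s ≤ t) :
    iteratedIntegral p u h t * primitive u s ≤ iteratedIntegral p u h s * primitive u t := by
  -- The value `(∫_s^∞ h)^p` separates the two averages: it is at most the mean over `(0, s)` and at
  -- least the mean over `[s, t)`.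
  have h1 : (∫⁻ z in Ioi s, h z) ^ p * primitive u s ≤ iteratedIntegral p u h s := by
    rw [primitive, ← hu.lintegral_const_mul _ Ioo_subset_Ioi_self]
    refine setLIntegral_mono' measurableSet_Ioo fun y hy => ?_
    exact mul_le_mul' (ENNReal.rpow_le_rpow (lintegral_tail_anti h hy.2.le) hp.le) le_rfl
  have h2 : ∫⁻ y in Ico s t, (∫⁻ z in Ioi y, h z) ^ p * ENNReal.ofReal (u y) ≤
      (∫⁻ z in Ioi s, h z) ^ p * ∫⁻ y in Ico s t, ENNReal.ofReal (u y) := by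
    rw [← hu.lintegral_const_mul _ (fun y hy => hs.trans_le hy.1)]
    refine setLIntegral_mono' measurableSet_Ico fun y hy => ?_
    exact mul_le_mul' (ENNReal.rpow_le_rpow (lintegral_tail_anti h hy.1) hp.le) le_rfl
  have h3 : primitive u t = primitive u s + ∫⁻ y in Ico s t, ENNReal.ofReal (u y) :=
    lintegral_Ioo_split _ hs hst
  have h4 : iteratedIntegral p u h t = iteratedIntegral p u h s +
      ∫⁻ y in Ico s t, (∫⁻ z in Ioi y, h z) ^ p * ENNReal.ofReal (u y) :=
    lintegral_Ioo_split _ hs hst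
  rw [h3, h4, add_mul, mul_add]
  refine add_le_add_right ?_ _
  calc _ ≤ ((∫⁻ z in Ioi s, h z) ^ p * ∫⁻ y in Ico s t, ENNReal.ofReal (u y)) *
        primitive u s := mul_le_mul' h2 le_rfl
    _ = ((∫⁻ z in Ioi s, h z) ^ p * primitive u s) *
        ∫⁻ y in Ico s t, ENNReal.ofReal (u y) := by ring
    _ ≤ _ := mul_le_mul' h1 le_rfl

/-- `(∫_0^t (∫_s^∞ h)^p u(s) ds)^(1/p)`. -/
noncomputable def iteratedNorm (p : ℝ) (u : ℝ → ℝ) (h : ℝ → ℝ≥0∞) (t : ℝ) : ℝ≥0∞ :=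
  iteratedIntegral p u h t ^ (1 / p)

theorem iteratedNorm_mono {p : ℝ} (hp : 0 < p) (u : ℝ → ℝ) (h : ℝ → ℝ≥0∞) :
    Monotone (iteratedNorm p u h) :=
  fun _ _ hst => ENNReal.rpow_le_rpow (iteratedIntegral_mono p u h hst) (by positivity)

theorem iteratedNorm_mul_primitivePow_le {p : ℝ} (hp : 0 < p) {u : ℝ → ℝ} (hu : IsWeight u)
    (h : ℝ → ℝ≥0∞) {s t : ℝ} (hs : 0 < s) (hst : s ≤ t) :
    iteratedNorm p u h t * primitivePow p u s ≤ iteratedNorm p u h s * primitivePow p u t := by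
  have hp' : 0 ≤ 1 / p := by positivity
  rw [iteratedNorm, iteratedNorm, primitivePow, primitivePow, ← ENNReal.mul_rpow_of_nonneg _ _ hp',
    ← ENNReal.mul_rpow_of_nonneg _ _ hp']
  exact ENNReal.rpow_le_rpow (iteratedIntegral_mul_primitive_le hp hu h hs hst) hp'

/-! ### Replacing the weight `w` by `φ` -/

theorem Admissible.ne_top {G : ℝ → ℝ≥0∞} (hG : Admissible G) {t : ℝ} (ht : 0 < t) : G t ≠ ⊤ :=
  (hG.finite t ht.le).ne

theorem Admissible.ne_zero {G : ℝ → ℝ≥0∞} (hG : Admissible G) {t : ℝ} (ht : 0 < t) : G t ≠ 0 := by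
  have := hG.strictMonoOn (self_mem_Ici) (mem_Ici.2 ht.le) ht
  rw [hG.zero] at this
  exact this.ne'

/-- For `s < t`, monotonicity gives `G ≥ G s` on `(s, t)`, a set of positive measure; continuity
then lets `s` tend to `t`. -/
theorem Admissible.le_essSup {G : ℝ → ℝ≥0∞} (hG : Admissible G) {t : ℝ} (ht : 0 < t) :
    G t ≤ essSup G (volume.restrict (Ioo 0 t)) := by
  have hlim : Tendsto G (𝓝[Ioo 0 t] t) (𝓝 (G t)) :=
    (hG.continuousOn t ht.le).mono_left (nhdsWithin_mono _ fun s hs => hs.1.le)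
  have : (𝓝[Ioo 0 t] t).NeBot := by
    rw [nhdsWithin_Ioo_eq_nhdsLT ht]; infer_instance
  refine le_of_tendsto hlim ?_
  filter_upwards [self_mem_nhdsWithin] with s hs
  have hne : volume.restrict (Ioo s t) ≠ 0 := by
    rw [Ne, Measure.restrict_eq_zero, Real.volume_Ioo, ENNReal.ofReal_eq_zero]
    linarith [hs.2]
  calc G s = essSup (fun _ => G s) (volume.restrict (Ioo s t)) := (essSup_const _ hne).symm
    _ ≤ essSup G (volume.restrict (Ioo s t)) := by
      refine essSup_mono_ae ?_
      filter_upwards [ae_restrict_mem measurableSet_Ioo] with y hy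
      exact hG.strictMonoOn.monotoneOn hs.1.le (hs.1.trans hy.1).le hy.1.le
    _ ≤ _ := essSup_mono_measure
      (Measure.restrict_mono (Ioo_subset_Ioo_left hs.1.le) le_rfl).absolutelyContinuous

theorem ofReal_le_phi {p : ℝ} {u w : ℝ → ℝ} (hG : Admissible (primitivePow p u)) :
    ∀ᵐ t ∂volume.restrict (Ioi (0 : ℝ)), ENNReal.ofReal (w t) ≤ phi p u w t := by
  -- The exceptional null set of the inner essential supremum depends on `s`. Rational cut-offs `q`
  -- leave a single null set, and a rational between `s` and `t` recovers every `s < t`.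
  have h1 : ∀ q : ℚ, ∀ᵐ t : ℝ, (q : ℝ) < t → ENNReal.ofReal (w t) / primitivePow p u t ≤
      essSup (fun τ => ENNReal.ofReal (w τ) / primitivePow p u τ)
        (volume.restrict (Ioi (q : ℝ))) := by
    intro q
    exact (ae_restrict_iff' measurableSet_Ioi).1 (ENNReal.ae_le_essSup _)
  rw [ae_restrict_iff' measurableSet_Ioi]
  filter_upwards [ae_all_iff.2 h1] with t ht ht0
  have ht0 : 0 < t := ht0
  have h2 : essSup (fun s => ENNReal.ofReal (w t) / primitivePow p u t * primitivePow p u s)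
      (volume.restrict (Ioo 0 t)) ≤ phi p u w t := by
    refine essSup_mono_ae ?_
    filter_upwards [ae_restrict_mem measurableSet_Ioo] with s hs
    rw [mul_comm]
    refine mul_le_mul_right ?_ _
    obtain ⟨q, hq1, hq2⟩ := exists_rat_btwn hs.2
    exact (ht q hq2).trans (essSup_mono_measure
      (Measure.restrict_mono (Ioi_subset_Ioi hq1.le) le_rfl).absolutelyContinuous)
  rw [ENNReal.essSup_const_mul] at h2
  calc ENNReal.ofReal (w t) = ENNReal.ofReal (w t) / primitivePow p u t * primitivePow p u t :=
        (ENNReal.div_mul_cancel (hG.ne_zero ht0) (hG.ne_top ht0)).symm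
    _ ≤ _ := by gcongr; exact hG.le_essSup ht0
    _ ≤ _ := h2

/-- For `s < t` the second hypothesis gives `F(t) G(s) / G(t) ≤ F(s)`, and `F(s) ≤ F(τ)` for `τ >
s`, so `F` can be moved inside the inner essential supremum that defines `φ`. -/
theorem phi_div_mul_le_essSup {p : ℝ} {u w : ℝ → ℝ} {F : ℝ → ℝ≥0∞} (hF : Monotone F)
    (hFG : ∀ s t, 0 < s → s ≤ t → F t * primitivePow p u s ≤ F s * primitivePow p u t)
    (t : ℝ) :
    phi p u w t / primitivePow p u t * F t ≤
      essSup (fun τ => ENNReal.ofReal (w τ) / primitivePow p u τ * F τ)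
        (volume.restrict (Ioi 0)) := by
  have h1 : phi p u w t / primitivePow p u t * F t =
      F t / primitivePow p u t * phi p u w t := by
    simp only [div_eq_mul_inv]; ring
  rw [h1, phi, ← ENNReal.essSup_const_mul]
  refine essSup_le_of_ae_le _ ?_
  filter_upwards [ae_restrict_mem measurableSet_Ioo] with s hs
  calc _ = F t * primitivePow p u s / primitivePow p u t *
        essSup (fun τ => ENNReal.ofReal (w τ) / primitivePow p u τ) (volume.restrict (Ioi s)) := by
        simp only [div_eq_mul_inv]; ring
    _ ≤ F s * essSup (fun τ => ENNReal.ofReal (w τ) / primitivePow p u τ)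
        (volume.restrict (Ioi s)) :=
        mul_le_mul' (ENNReal.div_le_of_le_mul (hFG s t hs.1 hs.2.le)) le_rfl
    _ = essSup (fun τ => F s * (ENNReal.ofReal (w τ) / primitivePow p u τ))
        (volume.restrict (Ioi s)) := ENNReal.essSup_const_mul.symm
    _ ≤ essSup (fun τ => ENNReal.ofReal (w τ) / primitivePow p u τ * F τ)
        (volume.restrict (Ioi s)) := by
        refine essSup_mono_ae ?_
        filter_upwards [ae_restrict_mem measurableSet_Ioi] with τ hτ
        rw [mul_comm]
        exact mul_le_mul' le_rfl (hF (le_of_lt hτ))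
    _ ≤ _ := essSup_mono_measure
        (Measure.restrict_mono (Ioi_subset_Ioi hs.1.le) le_rfl).absolutelyContinuous

/-- The left-hand side of the iterated Hardy inequality. -/
noncomputable def hardyLHS (p : ℝ) (u w : ℝ → ℝ) (h : ℝ → ℝ≥0∞) : ℝ≥0∞ :=
  essSup (fun t => ENNReal.ofReal (w t) *
      (1 / primitive u t *
        ∫⁻ s in Ioo 0 t, (∫⁻ z in Ioi s, h z) ^ p * ENNReal.ofReal (u s)) ^ (1 / p))
    (volume.restrict (Ioi 0))

theorem hardyLHS_eq {p : ℝ} (hp : 0 < p) (u w : ℝ → ℝ) (h : ℝ → ℝ≥0∞) :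
    hardyLHS p u w h =
      essSup (fun t => ENNReal.ofReal (w t) / primitivePow p u t * iteratedNorm p u h t)
        (volume.restrict (Ioi 0)) := by
  unfold hardyLHS
  congr 1
  ext t
  rw [ENNReal.mul_rpow_of_nonneg _ _ (by positivity), one_div (primitive u t), ENNReal.inv_rpow,
    ← mul_assoc, ← div_eq_mul_inv]
  rfl

theorem le_hardyLHS {p : ℝ} (hp : 0 < p) {u w : ℝ → ℝ} (hu : IsWeight u)
    (h : ℝ → ℝ≥0∞) (t : ℝ) :
    phi p u w t / primitivePow p u t * iteratedNorm p u h t ≤ hardyLHS p u w h := by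
  rw [hardyLHS_eq hp]
  exact phi_div_mul_le_essSup (iteratedNorm_mono hp u h)
    (fun s t hs hst => iteratedNorm_mul_primitivePow_le hp hu h hs hst) t

theorem hardyLHS_le {p : ℝ} (hp : 0 < p) {u w : ℝ → ℝ}
    (hG : Admissible (primitivePow p u)) (h : ℝ → ℝ≥0∞) {L : ℝ≥0∞}
    (hL : ∀ t, 0 < t → phi p u w t / primitivePow p u t * iteratedNorm p u h t ≤ L) :
    hardyLHS p u w h ≤ L := by
  rw [hardyLHS_eq hp]
  refine essSup_le_of_ae_le _ ?_
  filter_upwards [ofReal_le_phi (w := w) hG, ae_restrict_mem measurableSet_Ioi] with t ht ht0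
  exact le_trans (mul_le_mul' (ENNReal.div_le_div_right ht _) le_rfl) (hL t ht0)

/-! ### Lower estimate of the best constant -/

theorem wnorm_one (v : ℝ → ℝ) (I : Set ℝ) (h : ℝ → ℝ≥0∞) :
    wnorm 1 v I h = ∫⁻ s in I, h s * ENNReal.ofReal (v s) := by
  simp [wnorm]

theorem wnorm_one_one (I : Set ℝ) (h : ℝ → ℝ≥0∞) :
    wnorm 1 (fun _ => 1) I h = ∫⁻ s in I, h s := by
  simp [wnorm]

/-- The testing step behind both lower estimates: a function on `(a, b)` is extended by zero, and
`t` stays free so that it can be taken at either endpoint. -/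
theorem HardyIneq.indicator {p : ℝ} (hp : 0 < p) {u v w : ℝ → ℝ} {c : ℝ≥0}
    (hc : HardyIneq p u v w c) (hu : IsWeight u) {a b : ℝ} (ha : 0 < a) (t : ℝ)
    {h : ℝ → ℝ≥0∞} (hh : MPlus (Ioo a b) h) :
    phi p u w t / primitivePow p u t * iteratedNorm p u ((Ioo a b).indicator h) t ≤
      c * wnorm 1 v (Ioo a b) h := by
  have hm : MPlus (Ioi 0) ((Ioo a b).indicator h) :=
    ((aemeasurable_indicator_iff measurableSet_Ioo).2 hh).restrict
  refine (le_hardyLHS hp hu _ t).trans ((hc _ hm).trans_eq ?_)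
  have h1 : (fun z => (Ioo a b).indicator h z * ENNReal.ofReal (v z)) =
      (Ioo a b).indicator fun z => h z * ENNReal.ofReal (v z) := by
    ext z
    by_cases hz : z ∈ Ioo a b <;> simp [hz]
  rw [h1, setLIntegral_indicator measurableSet_Ioo, wnorm_one,
    inter_eq_left.2 (show Ioo a b ⊆ Ioi 0 from fun z hz => ha.trans hz.1)]

theorem phi_div_mul_constB_le {p : ℝ} (hp : 0 < p) {u v w : ℝ → ℝ} {c : ℝ≥0}
    (hc : HardyIneq p u v w c) (hu : IsWeight u) {a b : ℝ} (ha : 0 < a) :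
    phi p u w b / primitivePow p u b * constB p u v a b ≤ c := by
  simp only [constB, ENNReal.mul_iSup]
  refine iSup₂_le fun h hh => ?_
  rw [← mul_div_assoc]
  refine ENNReal.div_le_of_le_mul ((mul_le_mul' le_rfl ?_).trans
    (hc.indicator hp hu ha b hh))
  refine ENNReal.rpow_le_rpow ?_ (by positivity)
  refine (setLIntegral_mono' measurableSet_Ioo fun s hs => ?_).trans
    (lintegral_mono_set (Ioo_subset_Ioo_left ha.le))
  refine mul_le_mul' (ENNReal.rpow_le_rpow ?_ hp.le) le_rfl
  rw [setLIntegral_indicator measurableSet_Ioo]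
  exact lintegral_mono_set fun z hz => ⟨⟨hs.1.trans hz.1, hz.2⟩, hz.1⟩

theorem phi_mul_constC_le {p : ℝ} (hp : 0 < p) {u v w : ℝ → ℝ} {c : ℝ≥0}
    (hc : HardyIneq p u v w c) (hu : IsWeight u) (hG : Admissible (primitivePow p u))
    {a b : ℝ} (ha : 0 < a) :
    phi p u w a * constC v a b ≤ c := by
  simp only [constC, ENNReal.mul_iSup]
  refine iSup₂_le fun h hh => ?_
  rw [← mul_div_assoc]
  refine ENNReal.div_le_of_le_mul (le_trans ?_ (hc.indicator hp hu ha a hh))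
  rw [wnorm_one_one]
  -- For `s < a` the tail of the extended function contains all of `∫_a^b h`, so this constant comes
  -- out of the norm.
  have h1 : (∫⁻ z in Ioo a b, h z) * primitivePow p u a ≤
      iteratedNorm p u ((Ioo a b).indicator h) a := by
    rw [primitivePow, iteratedNorm]
    nth_rw 1 [← ENNReal.rpow_rpow_inv hp.ne' (∫⁻ z in Ioo a b, h z)]
    rw [← one_div, ← ENNReal.mul_rpow_of_nonneg _ _ (by positivity)]
    refine ENNReal.rpow_le_rpow ?_ (by positivity)
    rw [primitive, ← hu.lintegral_const_mul _ Ioo_subset_Ioi_self]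
    refine setLIntegral_mono' measurableSet_Ioo fun s hs => ?_
    refine mul_le_mul' (ENNReal.rpow_le_rpow ?_ hp.le) le_rfl
    rw [setLIntegral_indicator measurableSet_Ioo]
    exact lintegral_mono_set fun z hz => ⟨hz, hs.2.trans hz.1⟩
  calc _ = phi p u w a / primitivePow p u a * primitivePow p u a * ∫⁻ z in Ioo a b, h z := by
        rw [ENNReal.div_mul_cancel (hG.ne_zero ha) (hG.ne_top ha)]
    _ = phi p u w a / primitivePow p u a * ((∫⁻ z in Ioo a b, h z) * primitivePow p u a) := by ring
    _ ≤ _ := by gcongr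

theorem constD_le_two_mul {p : ℝ} (hp : 0 < p) {u v w : ℝ → ℝ} {c : ℝ≥0}
    (hc : HardyIneq p u v w c) (hu : IsWeight u) (hG : Admissible (primitivePow p u))
    {x : ℤ → ℝ} (hx : ∀ k, 0 < x k) :
    constD p u v w x ≤ 2 * c := by
  rw [two_mul]
  exact add_le_add
    (iSup_le fun k => phi_div_mul_constB_le hp hc hu (hx _))
    (iSup_le fun k => phi_mul_constC_le hp hc hu hG (hx _))

end IteratedHardy
namespace IteratedHardy

/-! ### Geometric sequences and the induced partition of `(0, ∞)` -/

theorem le_inv_mul_succ {a : ℤ → ℝ≥0∞} {r : ℝ≥0} (hr : 1 < r)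
    (h : (r : ℝ≥0∞) ≤ ⨅ k, a (k + 1) / a k) (k : ℤ) : a k ≤ (r : ℝ≥0∞)⁻¹ * a (k + 1) := by
  have h1 : r * a k ≤ a (k + 1) := ENNReal.mul_le_of_le_div (h.trans (iInf_le _ k))
  have hr0 : (r : ℝ≥0∞) ≠ 0 := by exact_mod_cast (zero_lt_one.trans hr).ne'
  calc a k = (r : ℝ≥0∞)⁻¹ * (r * a k) := by
        rw [← mul_assoc, ENNReal.inv_mul_cancel hr0 ENNReal.coe_ne_top, one_mul]
    _ ≤ _ := by gcongr

theorem le_pow_mul_add {a : ℤ → ℝ≥0∞} {ρ : ℝ≥0∞} (h : ∀ k, a k ≤ ρ * a (k + 1)) (k : ℤ) (n : ℕ) :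
    a k ≤ ρ ^ n * a (k + n) := by
  induction n with
  | zero => simp
  | succ n ih =>
    calc a k ≤ ρ ^ n * a (k + n) := ih
      _ ≤ ρ ^ n * (ρ * a (k + n + 1)) := by gcongr; exact h _
      _ = _ := by rw [pow_succ, mul_assoc]; push_cast; rw [add_assoc]

theorem le_pow_mul_sub {a : ℤ → ℝ≥0∞} {ρ : ℝ≥0∞} (h : ∀ k, a (k + 1) ≤ ρ * a k) (k : ℤ) (n : ℕ) :
    a k ≤ ρ ^ n * a (k - n) := by
  have := le_pow_mul_add (a := fun j => a (-j)) (ρ := ρ)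
    (fun j => by
      have h1 := h (-j - 1)
      rwa [sub_add_cancel, show -j - 1 = -(j + 1) by ring] at h1) (-k) n
  simp only [neg_neg] at this
  rwa [show -(-k + (n : ℤ)) = k - n by ring] at this

namespace IsDiscretizingWith

variable {r K : ℝ≥0} {G φ : ℝ → ℝ≥0∞} {x : ℤ → ℝ}

theorem G_le (hx : IsDiscretizingWith r K G φ x) (hr : 1 < r) (k : ℤ) :
    G (x k) ≤ (r : ℝ≥0∞)⁻¹ * G (x (k + 1)) :=
  le_inv_mul_succ (a := fun k => G (x k)) hr hx.ratio_G k

theorem phi_le (hx : IsDiscretizingWith r K G φ x) (hr : 1 < r) (k : ℤ) :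
    φ (x k) ≤ (r : ℝ≥0∞)⁻¹ * φ (x (k + 1)) :=
  le_inv_mul_succ (a := fun k => φ (x k)) hr hx.ratio_phi k

theorem div_le (hx : IsDiscretizingWith r K G φ x) (k : ℤ) :
    φ (x (k + 1)) / G (x (k + 1)) ≤ (r : ℝ≥0∞)⁻¹ * (φ (x k) / G (x k)) :=
  (ENNReal.div_le_iff_le_mul (Or.inl (hx.isDiscretizing.geom_div.1 k).1.ne')
    (Or.inl (hx.isDiscretizing.geom_div.1 k).2.ne)).1
    ((le_iSup (fun k => φ (x (k + 1)) / G (x (k + 1)) / (φ (x k) / G (x k))) k).trans hx.ratio_div)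

theorem strictMono (hx : IsDiscretizingWith r K G φ x) (hr : 1 < r) (hG : Admissible G) :
    StrictMono x := by
  refine strictMono_int_of_lt_succ fun k => ?_
  by_contra! hle
  have h1 : G (x (k + 1)) ≤ G (x k) := hG.strictMonoOn.monotoneOn
    (hx.isDiscretizing.pos _).le (hx.isDiscretizing.pos _).le hle
  have hG0 := hx.isDiscretizing.geom_G.1 (k + 1)
  have h2 : G (x (k + 1)) < 1 * G (x (k + 1)) :=
    (h1.trans (hx.G_le hr k)).trans_lt
      (ENNReal.mul_lt_mul_left hG0.1.ne' hG0.2.ne (ENNReal.inv_lt_one.2 (by exact_mod_cast hr)))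
  simp at h2

/-- Geometric growth forces `G(x_k)` to `0` at `-∞` and to `∞` at `+∞`, so there is a greatest `k`
with `x_k < t`. -/
theorem exists_mem_Ioc (hx : IsDiscretizingWith r K G φ x) (hr : 1 < r) (hG : Admissible G)
    {t : ℝ} (ht : 0 < t) : ∃ k, t ∈ Ioc (x k) (x (k + 1)) := by
  have hmono := hx.strictMono hr hG
  have hρ : (r : ℝ≥0∞)⁻¹ < 1 := ENNReal.inv_lt_one.2 (by exact_mod_cast hr)
  have hpow := ENNReal.tendsto_pow_atTop_nhds_zero_of_lt_one hρ
  have key : ∀ {c : ℝ≥0∞}, c ≠ ⊤ → Tendsto (fun n : ℕ => (r : ℝ≥0∞)⁻¹ ^ n * c) atTop (𝓝 0) :=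
    fun hc => by simpa using ENNReal.Tendsto.mul_const hpow (Or.inr hc)
  have hlow : ∃ k, x k < t := by
    obtain ⟨n, hn⟩ := ((key (hG.ne_top (hx.isDiscretizing.pos 0))).eventually_lt_const
      (pos_iff_ne_zero.2 (hG.ne_zero ht))).exists
    refine ⟨-n, ?_⟩
    have h1 := le_pow_mul_add (hx.G_le hr) (-n) n
    rw [neg_add_cancel] at h1
    by_contra! hle
    exact absurd (hG.strictMonoOn.monotoneOn ht.le (hx.isDiscretizing.pos _).le hle)
      (not_le.2 (h1.trans_lt hn))
  have hhigh : ∃ b : ℤ, ∀ k, x k < t → k ≤ b := by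
    obtain ⟨n, hn⟩ := ((key (hG.ne_top ht)).eventually_lt_const
      (hx.isDiscretizing.geom_G.1 0).1).exists
    refine ⟨n, fun k hk => ?_⟩
    by_contra! hle
    have h1 := le_pow_mul_add (hx.G_le hr) 0 n
    rw [zero_add] at h1
    have h2 : G (x n) ≤ G t := hG.strictMonoOn.monotoneOn (hx.isDiscretizing.pos _).le ht.le
      ((hmono hle).trans hk).le
    exact absurd (h1.trans (mul_le_mul' le_rfl h2)) (not_le.2 hn)
  obtain ⟨k, hk, hk'⟩ := Int.exists_greatest_of_bdd hhigh hlow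
  refine ⟨k, hk, ?_⟩
  by_contra! hlt
  have := hk' _ hlt
  omega

theorem Ioi_subset (hx : IsDiscretizingWith r K G φ x) (hr : 1 < r) (hG : Admissible G) (k : ℤ) :
    Ioi (x k) ⊆ ⋃ n : ℕ, Ioc (x (k + n)) (x (k + n + 1)) := by
  intro t ht
  obtain ⟨j, hj⟩ := hx.exists_mem_Ioc hr hG ((hx.isDiscretizing.pos k).trans ht)
  have h1 : k < j + 1 := (hx.strictMono hr hG).lt_iff_lt.1 (lt_of_lt_of_le ht hj.2)
  refine mem_iUnion.2 ⟨(j - k).toNat, ?_⟩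
  have h2 : k + ((j - k).toNat : ℤ) = j := by omega
  rwa [h2]

theorem Ioo_subset (hx : IsDiscretizingWith r K G φ x) (hr : 1 < r) (hG : Admissible G) (k : ℤ) :
    Ioo 0 (x k) ⊆ ⋃ n : ℕ, Ioc (x (k - n - 1)) (x (k - n)) := by
  intro t ht
  obtain ⟨j, hj⟩ := hx.exists_mem_Ioc hr hG ht.1
  have h1 : j < k := (hx.strictMono hr hG).lt_iff_lt.1 (hj.1.trans ht.2)
  refine mem_iUnion.2 ⟨(k - j - 1).toNat, ?_⟩
  have h2 : k - ((k - j - 1).toNat : ℤ) = j + 1 := by omega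
  rw [h2, add_sub_cancel_right]
  exact hj

end IsDiscretizingWith

/-! ### Upper estimate of the best constant -/

theorem setLIntegral_Ioc_eq_Ioo (f : ℝ → ℝ≥0∞) (a b : ℝ) :
    ∫⁻ z in Ioc a b, f z = ∫⁻ z in Ioo a b, f z :=
  setLIntegral_congr Ioo_ae_eq_Ioc.symm

/-- Clears the denominator in the suprema `B` and `C` despite the conventions of `ℝ≥0∞`: `n ≤ S < ∞`
rules out division by `∞`, and `c ≠ 0`, `d < ∞` force `q < ∞`, so that `n = 0` entails `m = 0`. -/
theorem mul_le_mul_of_mul_div_le {c q d n S : ℝ≥0∞} (hc : c ≠ 0) (hd : d ≠ ⊤) (hS : n ≤ S)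
    (hS' : S ≠ ⊤) {m : ℝ≥0∞} (hm : m / n ≤ q) (hq : c * q ≤ d) : c * m ≤ d * S := by
  have hq' : q ≠ ⊤ := by
    rintro rfl
    rw [ENNReal.mul_top hc, top_le_iff] at hq
    exact hd hq
  calc c * m ≤ c * (q * n) := by
        gcongr
        exact (ENNReal.div_le_iff_le_mul (Or.inr hq') (Or.inl (hS.trans_lt hS'.lt_top).ne)).1 hm
    _ = (c * q) * n := by ring
    _ ≤ d * S := by gcongr

/-- Bounding the sum by twice the maximum treats `p < 1` and `p ≥ 1` alike. -/
theorem add_rpow_le {p : ℝ} (hp : 0 < p) (a b : ℝ≥0∞) :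
    (a + b) ^ p ≤ 2 ^ p * (a ^ p + b ^ p) := by
  rcases le_total a b with h | h
  · calc (a + b) ^ p ≤ (2 * b) ^ p := by rw [two_mul]; gcongr
      _ = 2 ^ p * b ^ p := ENNReal.mul_rpow_of_nonneg _ _ hp.le
      _ ≤ _ := by gcongr; exact le_add_self
  · calc (a + b) ^ p ≤ (2 * a) ^ p := by rw [two_mul]; gcongr
      _ = 2 ^ p * a ^ p := ENNReal.mul_rpow_of_nonneg _ _ hp.le
      _ ≤ _ := by gcongr; exact le_self_add

/-- The constant in the upper estimate of `φ(x_k) U(x_k)^(-1/p) (∫_0^{x_k} (∫_s^∞ h)^p u)^(1/p)`. -/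
noncomputable def sumConst (p : ℝ) (r : ℝ≥0) : ℝ≥0∞ :=
  -- The outer factor sums over the blocks, `2 ^ p` is the cost of splitting the tail, and the inner
  -- geometric sum comes from `phi_mul_tail_le`.
  ((1 - (r : ℝ≥0∞)⁻¹ ^ p)⁻¹ * (2 ^ p * (1 + ((1 - (r : ℝ≥0∞)⁻¹)⁻¹) ^ p))) ^ (1 / p)

theorem sumConst_ne_top {p : ℝ} (hp : 0 < p) {r : ℝ≥0} (hr : 1 < r) : sumConst p r ≠ ⊤ := by
  have hρ : (r : ℝ≥0∞)⁻¹ < 1 := ENNReal.inv_lt_one.2 (by exact_mod_cast hr)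
  refine ENNReal.rpow_ne_top_of_nonneg (by positivity) (ENNReal.mul_ne_top ?_
    (ENNReal.mul_ne_top (ENNReal.rpow_ne_top_of_nonneg hp.le (by simp))
      (ENNReal.add_ne_top.2 ⟨by simp, ENNReal.rpow_ne_top_of_nonneg hp.le ?_⟩)))
  · exact ENNReal.inv_ne_top.2 (tsub_pos_of_lt (ENNReal.rpow_lt_one hρ hp)).ne'
  · exact ENNReal.inv_ne_top.2 (tsub_pos_of_lt hρ).ne'

section Upper

variable {p : ℝ} {r K : ℝ≥0} {u v w : ℝ → ℝ} {x : ℤ → ℝ} {h : ℝ → ℝ≥0∞} {Q : ℝ≥0∞}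

/-- Since `φ(x_k) ≤ r^(-n) φ(x_{k+n})`, the `n`-th interval to the right of `x_k` contributes at
most `r^(-n) Q`. -/
theorem phi_mul_tail_le (hx : IsDiscretizingWith r K (primitivePow p u) (phi p u w) x)
    (hr : 1 < r) (hG : Admissible (primitivePow p u))
    (hC : ∀ k, phi p u w (x k) * ∫⁻ z in Ioo (x k) (x (k + 1)), h z ≤ Q) (k : ℤ) :
    phi p u w (x k) * ∫⁻ z in Ioi (x k), h z ≤ (1 - (r : ℝ≥0∞)⁻¹)⁻¹ * Q := by
  calc _ ≤ phi p u w (x k) * ∑' n : ℕ, ∫⁻ z in Ioc (x (k + n)) (x (k + n + 1)), h z :=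
        mul_le_mul' le_rfl ((lintegral_mono_set (hx.Ioi_subset hr hG k)).trans
          (lintegral_iUnion_le _ _))
    _ = ∑' n : ℕ, phi p u w (x k) * ∫⁻ z in Ioc (x (k + n)) (x (k + n + 1)), h z :=
        ENNReal.tsum_mul_left.symm
    _ ≤ ∑' n : ℕ, (r : ℝ≥0∞)⁻¹ ^ n * Q := by
        refine ENNReal.tsum_le_tsum fun n => ?_
        rw [setLIntegral_Ioc_eq_Ioo]
        refine (mul_le_mul' (le_pow_mul_add (hx.phi_le hr) k n) le_rfl).trans ?_
        rw [mul_assoc]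
        exact mul_le_mul' le_rfl (hC _)
    _ = _ := by rw [ENNReal.tsum_mul_right, ENNReal.tsum_geometric]

theorem lintegral_tail_le (h : ℝ → ℝ≥0∞) {s b : ℝ} (hs : s ≤ b) :
    ∫⁻ z in Ioi s, h z ≤ (∫⁻ z in Ioo s b, h z) + ∫⁻ z in Ioi b, h z := by
  rw [← Ioc_union_Ioi_eq_Ioi hs, ← setLIntegral_Ioc_eq_Ioo]
  exact lintegral_union_le _ _ _

/-- Split `∫_s^∞ h` at `b`. The part up to `b` is what `hB` controls; the part beyond `b` does not
depend on `s`, its norm is at most `G(b) ∫_b^∞ h`, and `G(b)` cancels to leave `hT`. -/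
theorem rpow_mul_lintegral_block_le (hp : 0 < p) (hu : IsWeight u)
    (hG : Admissible (primitivePow p u)) {a b : ℝ} (ha : 0 < a) (hb : 0 < b) {Q' : ℝ≥0∞}
    (hB : phi p u w b / primitivePow p u b *
      wnorm p u (Ioo a b) (fun s => ∫⁻ z in Ioo s b, h z) ≤ Q)
    (hT : phi p u w b * ∫⁻ z in Ioi b, h z ≤ Q') :
    (phi p u w b / primitivePow p u b) ^ p *
      ∫⁻ s in Ioc a b, (∫⁻ z in Ioi s, h z) ^ p * ENNReal.ofReal (u s) ≤
    2 ^ p * (Q ^ p + Q' ^ p) := by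
  have hsub : Ioo a b ⊆ Ioi 0 := fun s hs => ha.trans hs.1
  have h1 : ∫⁻ s in Ioo a b, (∫⁻ z in Ioi s, h z) ^ p * ENNReal.ofReal (u s) ≤
      2 ^ p * (wnorm p u (Ioo a b) (fun s => ∫⁻ z in Ioo s b, h z) ^ p +
        (∫⁻ z in Ioi b, h z) ^ p * primitivePow p u b ^ p) := by
    calc _ ≤ ∫⁻ s in Ioo a b, 2 ^ p * ((∫⁻ z in Ioo s b, h z) ^ p * ENNReal.ofReal (u s) +
          (∫⁻ z in Ioi b, h z) ^ p * ENNReal.ofReal (u s)) := by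
          refine setLIntegral_mono' measurableSet_Ioo fun s hs => ?_
          rw [← add_mul, ← mul_assoc]
          refine mul_le_mul' ?_ le_rfl
          exact (ENNReal.rpow_le_rpow (lintegral_tail_le h hs.2.le) hp.le).trans
            (add_rpow_le hp _ _)
      _ = 2 ^ p * ((∫⁻ s in Ioo a b, (∫⁻ z in Ioo s b, h z) ^ p * ENNReal.ofReal (u s)) +
          (∫⁻ z in Ioi b, h z) ^ p * ∫⁻ s in Ioo a b, ENNReal.ofReal (u s)) := by
          rw [lintegral_const_mul' _ _ (ENNReal.rpow_ne_top_of_nonneg hp.le (by simp)),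
            lintegral_add_right', hu.lintegral_const_mul _ hsub]
          exact (hu.aemeasurable_ofReal.mono_measure
            (Measure.restrict_mono hsub le_rfl)).const_mul _
      _ ≤ _ := by
          rw [wnorm, primitivePow, one_div, ENNReal.rpow_inv_rpow hp.ne',
            ENNReal.rpow_inv_rpow hp.ne']
          exact mul_le_mul' le_rfl (add_le_add_right (mul_le_mul' le_rfl
            (lintegral_mono_set (Ioo_subset_Ioo_left ha.le))) _)
  rw [setLIntegral_Ioc_eq_Ioo]
  refine (mul_le_mul' le_rfl h1).trans ?_
  rw [mul_left_comm, mul_add, ← ENNReal.mul_rpow_of_nonneg _ _ hp.le,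
    ← ENNReal.mul_rpow_of_nonneg _ _ hp.le, ← ENNReal.mul_rpow_of_nonneg _ _ hp.le]
  refine mul_le_mul' le_rfl (add_le_add (ENNReal.rpow_le_rpow hB hp.le)
    (ENNReal.rpow_le_rpow ?_ hp.le))
  rw [mul_comm (∫⁻ z in Ioi b, h z), ← mul_assoc,
    ENNReal.div_mul_cancel (hG.ne_zero hb) (hG.ne_top hb)]
  exact hT

/-- Since `φ / G` at `x_k` is at most `r^(-n)` times its value at `x_{k-n}`, the blocks to the left
of `x_k` form a geometric series. Summing `p`-th powers before taking the root avoids the triangle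
inequality, which fails for `p < 1`. -/
theorem phi_div_mul_iteratedNorm_le (hp : 0 < p) (hr : 1 < r) (hu : IsWeight u)
    (hG : Admissible (primitivePow p u))
    (hx : IsDiscretizingWith r K (primitivePow p u) (phi p u w) x)
    (hB : ∀ k, phi p u w (x k) / primitivePow p u (x k) *
      wnorm p u (Ioo (x (k - 1)) (x k)) (fun s => ∫⁻ z in Ioo s (x k), h z) ≤ Q)
    (hC : ∀ k, phi p u w (x k) * ∫⁻ z in Ioo (x k) (x (k + 1)), h z ≤ Q) (k : ℤ) :
    phi p u w (x k) / primitivePow p u (x k) * iteratedNorm p u h (x k) ≤ sumConst p r * Q := by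
  have hpos := hx.isDiscretizing.pos
  have hblock := fun k => rpow_mul_lintegral_block_le hp hu hG (hpos (k - 1)) (hpos k) (hB k)
    (phi_mul_tail_le hx hr hG hC k)
  have hsum : (phi p u w (x k) / primitivePow p u (x k)) ^ p * iteratedIntegral p u h (x k) ≤
      (1 - (r : ℝ≥0∞)⁻¹ ^ p)⁻¹ * (2 ^ p * (Q ^ p + ((1 - (r : ℝ≥0∞)⁻¹)⁻¹ * Q) ^ p)) := by
    calc _ ≤ (phi p u w (x k) / primitivePow p u (x k)) ^ p *
          ∑' n : ℕ, ∫⁻ s in Ioc (x (k - n - 1)) (x (k - n)),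
            (∫⁻ z in Ioi s, h z) ^ p * ENNReal.ofReal (u s) :=
          mul_le_mul' le_rfl ((lintegral_mono_set (hx.Ioo_subset hr hG k)).trans
            (lintegral_iUnion_le _ _))
      _ = ∑' n : ℕ, (phi p u w (x k) / primitivePow p u (x k)) ^ p *
          ∫⁻ s in Ioc (x (k - n - 1)) (x (k - n)),
            (∫⁻ z in Ioi s, h z) ^ p * ENNReal.ofReal (u s) := ENNReal.tsum_mul_left.symm
      _ ≤ ∑' n : ℕ, ((r : ℝ≥0∞)⁻¹ ^ p) ^ n *
          (2 ^ p * (Q ^ p + ((1 - (r : ℝ≥0∞)⁻¹)⁻¹ * Q) ^ p)) := by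
          refine ENNReal.tsum_le_tsum fun n => ?_
          have h1 := le_pow_mul_sub
            (a := fun k => (phi p u w (x k) / primitivePow p u (x k)) ^ p)
            (ρ := (r : ℝ≥0∞)⁻¹ ^ p) (fun j => by
              rw [← ENNReal.mul_rpow_of_nonneg _ _ hp.le]
              exact ENNReal.rpow_le_rpow (hx.div_le j) hp.le) k n
          refine (mul_le_mul' h1 le_rfl).trans ?_
          rw [mul_assoc]
          exact mul_le_mul' le_rfl (hblock _)
      _ = _ := by rw [ENNReal.tsum_mul_right, ENNReal.tsum_geometric]
  have hp' : 0 ≤ 1 / p := by positivity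
  have h2 := ENNReal.rpow_le_rpow hsum hp'
  rw [ENNReal.mul_rpow_of_nonneg _ _ hp', one_div, ENNReal.rpow_rpow_inv hp.ne', ← one_div] at h2
  refine h2.trans_eq ?_
  rw [sumConst]
  nth_rw 3 [← ENNReal.rpow_rpow_inv hp.ne' Q]
  rw [← one_div p, ← ENNReal.mul_rpow_of_nonneg _ _ hp', ENNReal.mul_rpow_of_nonneg _ Q hp.le]
  congr 1
  ring

/-- On `Z₁` pass to the left endpoint, as `φ(t) ≤ K φ(x_k)` and `N / G` is nonincreasing. On `Z₂`
pass to the right endpoint, as `φ / G` is nearly constant and `N` is nondecreasing. The constant `K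
+ K ^ 2` covers both cases. -/
theorem hardyLHS_le_of_discrete (hp : 0 < p) (hr : 1 < r) (hu : IsWeight u)
    (hG : Admissible (primitivePow p u))
    (hx : IsDiscretizingWith r K (primitivePow p u) (phi p u w) x) {L : ℝ≥0∞}
    (hL : ∀ k, phi p u w (x k) / primitivePow p u (x k) * iteratedNorm p u h (x k) ≤ L) :
    hardyLHS p u w h ≤ (K + K ^ 2) * L := by
  refine hardyLHS_le hp hG h fun t ht => ?_
  obtain ⟨k, hk⟩ := hx.exists_mem_Ioc hr hG ht
  have hxk := hx.isDiscretizing.pos k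
  obtain ⟨Z₁, Z₂, hZ, -, h1, h2⟩ := hx.decomp
  rcases (hZ ▸ mem_univ k : k ∈ Z₁ ∪ Z₂) with hkZ | hkZ
  · have h3 := (h1 k hkZ t (Ioc_subset_Icc_self hk)).2
    have h4 : iteratedNorm p u h t / primitivePow p u t ≤
        iteratedNorm p u h (x k) / primitivePow p u (x k) := by
      refine ENNReal.div_le_of_le_mul ?_
      rw [ENNReal.mul_comm_div, ← mul_div_assoc, ENNReal.le_div_iff_mul_le
        (Or.inl (hG.ne_zero hxk)) (Or.inl (hG.ne_top hxk))]
      exact iteratedNorm_mul_primitivePow_le hp hu h hxk hk.1.le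
    calc _ = phi p u w t * (iteratedNorm p u h t / primitivePow p u t) := by
          simp only [div_eq_mul_inv]; ring
      _ ≤ (K * phi p u w (x k)) * (iteratedNorm p u h (x k) / primitivePow p u (x k)) :=
          mul_le_mul' h3 h4
      _ = K * (phi p u w (x k) / primitivePow p u (x k) * iteratedNorm p u h (x k)) := by
          simp only [div_eq_mul_inv]; ring
      _ ≤ _ := mul_le_mul' le_self_add (hL k)
  · have h3 := (h2 k hkZ t (Ioc_subset_Icc_self hk)).2
    -- The equivalence refers to `x_k`; using it again at `t = x_{k+1}` reaches the right endpoint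
    -- at the price of a second factor `K`.
    have h4 := (h2 k hkZ (x (k + 1)) (right_mem_Icc.2 (hx.strictMono hr hG (lt_add_one k)).le)).1
    calc _ ≤ (K * (K * (phi p u w (x (k + 1)) / primitivePow p u (x (k + 1))))) *
          iteratedNorm p u h (x (k + 1)) :=
          mul_le_mul' (h3.trans (mul_le_mul' le_rfl h4)) (iteratedNorm_mono hp u h hk.2)
      _ = K ^ 2 * (phi p u w (x (k + 1)) / primitivePow p u (x (k + 1)) *
          iteratedNorm p u h (x (k + 1))) := by ring
      _ ≤ _ := mul_le_mul' le_add_self (hL _)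

theorem hardyLHS_le_constD_mul (hp : 0 < p) (hr : 1 < r) (hu : IsWeight u)
    (hG : Admissible (primitivePow p u))
    (hx : IsDiscretizingWith r K (primitivePow p u) (phi p u w) x)
    (hD : constD p u v w x ≠ ⊤) (hh : MPlus (Ioi 0) h)
    (hS : ∫⁻ z in Ioi 0, h z * ENNReal.ofReal (v z) ≠ ⊤) :
    hardyLHS p u w h ≤ (K + K ^ 2) * sumConst p r * constD p u v w x *
      ∫⁻ z in Ioi 0, h z * ENNReal.ofReal (v z) := by
  have hpos := hx.isDiscretizing.pos
  have hm : ∀ j k, MPlus (Ioo (x j) (x k)) h := fun j k =>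
    hh.mono_measure (Measure.restrict_mono (fun z hz => (hpos j).trans hz.1) le_rfl)
  have hv : ∀ j k, wnorm 1 v (Ioo (x j) (x k)) h ≤
      ∫⁻ z in Ioi 0, h z * ENNReal.ofReal (v z) := fun j k => by
    rw [wnorm_one]
    exact lintegral_mono_set fun z hz => (hpos j).trans hz.1
  refine (hardyLHS_le_of_discrete hp hr hu hG hx
    (phi_div_mul_iteratedNorm_le hp hr hu hG hx
      (Q := constD p u v w x * ∫⁻ z in Ioi 0, h z * ENNReal.ofReal (v z))
      (fun k => ?_) (fun k => ?_))).trans_eq (by ring)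
  · exact mul_le_mul_of_mul_div_le (hx.isDiscretizing.geom_div.1 k).1.ne' hD (hv _ _) hS
      (le_iSup₂ (f := fun (h : ℝ → ℝ≥0∞) (_ : MPlus (Ioo (x (k - 1)) (x k)) h) =>
        wnorm p u (Ioo (x (k - 1)) (x k)) (fun s => ∫⁻ z in Ioo s (x k), h z) /
          wnorm 1 v (Ioo (x (k - 1)) (x k)) h) h (hm _ _))
      ((le_iSup (fun k => phi p u w (x k) / primitivePow p u (x k) *
        constB p u v (x (k - 1)) (x k)) k).trans le_self_add)
  · rw [← wnorm_one_one]
    exact mul_le_mul_of_mul_div_le (hx.isDiscretizing.geom_phi.1 k).1.ne' hD (hv _ _) hS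
      (le_iSup₂ (f := fun (h : ℝ → ℝ≥0∞) (_ : MPlus (Ioo (x k) (x (k + 1))) h) =>
        wnorm 1 (fun _ => 1) (Ioo (x k) (x (k + 1))) h /
          wnorm 1 v (Ioo (x k) (x (k + 1))) h) h (hm _ _))
      ((le_iSup (fun k => phi p u w (x k) * constC v (x k) (x (k + 1))) k).trans le_add_self)

/-- The inequality holds with every constant larger than the multiple of `constD`; since such a
constant is positive, the case `∫ h v = ∞` is trivial. -/
theorem hardyIneq_of_lt (hp : 0 < p) (hr : 1 < r) (hu : IsWeight u)
    (hG : Admissible (primitivePow p u))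
    (hx : IsDiscretizingWith r K (primitivePow p u) (phi p u w) x)
    (hD : constD p u v w x ≠ ⊤) {c : ℝ≥0}
    (hc : (K + K ^ 2) * sumConst p r * constD p u v w x < c) : HardyIneq p u v w c := by
  intro h hh
  by_cases hS : ∫⁻ z in Ioi 0, h z * ENNReal.ofReal (v z) = ⊤
  · rw [hS, ENNReal.mul_top (pos_of_gt hc).ne']
    exact le_top
  · exact (hardyLHS_le_constD_mul hp hr hu hG hx hD hh hS).trans (mul_le_mul' hc.le le_rfl)

theorem bestConst_le (hp : 0 < p) (hr : 1 < r) (hu : IsWeight u)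
    (hG : Admissible (primitivePow p u))
    (hx : IsDiscretizingWith r K (primitivePow p u) (phi p u w) x)
    (hD : constD p u v w x ≠ ⊤) :
    bestConst p u v w ≤ (K + K ^ 2) * sumConst p r * constD p u v w x := by
  -- The constant itself may be `0`, and `0 * ∞ = 0` would not cover `∫ h v = ∞`; hence the approach
  -- from above by `ε`.
  refine ENNReal.le_of_forall_pos_le_add fun ε hε hlt => ?_
  lift (K + K ^ 2) * sumConst p r * constD p u v w x to ℝ≥0 using hlt.ne with m hm
  rw [← ENNReal.coe_add]
  refine iInf₂_le (m + ε) (hardyIneq_of_lt hp hr hu hG hx hD ?_)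
  rw [← hm]
  exact_mod_cast lt_add_of_pos_right m hε

theorem constD_le (hp : 0 < p) (hu : IsWeight u) (hG : Admissible (primitivePow p u))
    (hx : ∀ k, 0 < x k) : constD p u v w x ≤ 2 * bestConst p u v w := by
  simp only [bestConst, ENNReal.mul_iInf_of_ne two_ne_zero ENNReal.ofNat_ne_top]
  exact le_iInf₂ fun c hc => constD_le_two_mul hp hc hu hG hx

end Upper

end IteratedHardy

theorem lemma3p2 (p : ℝ) (hp : 0 < p) (r K : ℝ≥0) (hr : 1 < r) :
    ∃ M : ℝ≥0, ∀ (u v w : ℝ → ℝ) (x : ℤ → ℝ),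
      IteratedHardy.IsWeight u → IteratedHardy.IsWeight v → IteratedHardy.IsWeight w →
      IteratedHardy.Admissible (IteratedHardy.primitivePow p u) →
      IteratedHardy.NonDegenerate (IteratedHardy.primitivePow p u)
        (IteratedHardy.phi p u w) →
      IteratedHardy.IsDiscretizingWith r K (IteratedHardy.primitivePow p u)
        (IteratedHardy.phi p u w) x →
      ((∃ c : ℝ≥0, IteratedHardy.HardyIneq p u v w c) ↔
          IteratedHardy.constD p u v w x < ⊤) ∧
        IteratedHardy.bestConst p u v w ≤ M * IteratedHardy.constD p u v w x ∧
        IteratedHardy.constD p u v w x ≤ M * IteratedHardy.bestConst p u v w := by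
  have hN : ((K : ℝ≥0∞) + K ^ 2) * IteratedHardy.sumConst p r ≠ ⊤ :=
    ENNReal.mul_ne_top (by simp) (IteratedHardy.sumConst_ne_top hp hr)
  -- The `2` serves the lower estimate, as `constD` is a sum of two suprema; it also keeps `M`
  -- nonzero, so that `M * ∞ = ∞` when `constD` is infinite.
  refine ⟨2 + (((K : ℝ≥0∞) + K ^ 2) * IteratedHardy.sumConst p r).toNNReal,
    fun u v w x hu _ _ hG _ hx => ?_⟩
  rw [ENNReal.coe_add, ENNReal.coe_toNNReal hN, ENNReal.coe_ofNat]
  refine ⟨⟨?_, fun hD => ?_⟩, ?_, ?_⟩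
  · rintro ⟨c, hc⟩
    exact (IteratedHardy.constD_le_two_mul hp hc hu hG hx.isDiscretizing.pos).trans_lt
      (ENNReal.mul_lt_top ENNReal.ofNat_lt_top ENNReal.coe_lt_top)
  · obtain ⟨c, hc, -⟩ := ENNReal.lt_iff_exists_nnreal_btwn.1 (ENNReal.mul_lt_top hN.lt_top hD)
    exact ⟨c, IteratedHardy.hardyIneq_of_lt hp hr hu hG hx hD.ne hc⟩
  · rcases eq_or_ne (IteratedHardy.constD p u v w x) ⊤ with hD | hD
    · rw [hD, ENNReal.mul_top (by simp)]
      exact le_top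
    · exact (IteratedHardy.bestConst_le hp hr hu hG hx hD).trans
        (mul_le_mul' le_add_self le_rfl)
  · exact (IteratedHardy.constD_le hp hu hG hx.isDiscretizing.pos).trans
      (mul_le_mul' le_self_add le_rfl)
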